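/- Let $\mathbb D=\{z\in\mathbb C:|z|<1\}$, let $-\infty<a<b<\infty$, $I=[a,b]$ and $I_+^2=\{(s,t):s,t\in I,\ s\le t\}$. An evolution family on $I$ is a family $\{\omega_{s,t}\}_{(s,t)\in I_+^2}$ of holomorphic maps $\omega_{s,t}:\mathbb D\to\mathbb D$ such that every $\omega_{s,t}$ is non-constant, $\omega_{t,t}=\mathrm{id}_{\mathbb D}$ for all $t\in I$, and $\omega_{u,t}\circ\omega_{s,u}=\omega_{s,t}$ whenever $s\le u\le t$ in $I$. It is called hyperbolically bounded if $\sup_{(s,t)\in I_+^2}|\omega_{s,t}(0)|<1$. Continuity of a family of holomorphic functions in its parameter is understood with respect to locally uniform convergence on $\mathbb D$. **Theorem 1.6.** Let $\{\omega_{s,t}\}_{(s,t)\in I_+^2}$ be an evolution family on $I=[a,b]$. Then the following are equivalent: (i) the family is jointly continuous, i.e. $I_+^2\ni(s,t)\mapsto\omega_{s,t}$ is continuous; (v) the family is hyperbolically bounded and continuous with respect to the left parameter, i.e. $[a,b]\ni s\mapsto\omega_{s,b}$ is continuous; (vi) the family is hyperbolically bounded; for every $c\in[a,b]$ one has $\omega_{s,t}(0)\to0$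 as $t-s\searrow0$ with $(s,t)\in I_+^2$, $s\le c\le t$; and $s\mapsto\omega_{s,b}'(0)$ is continuous on $[a,b]$ with $\omega_{s,b}'(0)\neq0$ for all $s\in[a,b]$. -/

import Mathlib

open Set Filter Topology

/-- The open unit disk of `ℂ`. -/
abbrev openUnitDisk : Set ℂ := Metric.ball 0 1

/-- `f` restricts to a holomorphic self-map of the unit disk; values of `f` off the disk are
irrelevant. -/
structure IsHolomorphicSelfMap (f : ℂ → ℂ) : Prop where
  differentiableOn : DifferentiableOn ℂ f openUnitDisk
  mapsTo : MapsTo f openUnitDisk openUnitDisk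

/-- The index set `I_+^2 = {(s, t) : s, t ∈ I, s ≤ t}`. -/
def orderedPairs (I : Set ℝ) : Set (ℝ × ℝ) :=
  {p | p.1 ∈ I ∧ p.2 ∈ I ∧ p.1 ≤ p.2}

/-- `ω s t`, for `(s, t) ∈ I_+^2`, is an evolution family of the unit disk. No continuity in the
parameters is required, and `ω s t` is unconstrained for `(s, t)` outside `I_+^2`. -/
structure IsEvolutionFamily (I : Set ℝ) (ω : ℝ → ℝ → ℂ → ℂ) : Prop where
  selfMap : ∀ s ∈ I, ∀ t ∈ I, s ≤ t → IsHolomorphicSelfMap (ω s t)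
  nonconstant : ∀ s ∈ I, ∀ t ∈ I, s ≤ t → ¬ ∃ w : ℂ, ∀ z ∈ openUnitDisk, ω s t z = w
  diagonal : ∀ t ∈ I, ∀ z ∈ openUnitDisk, ω t t z = z
  comp : ∀ s ∈ I, ∀ u ∈ I, ∀ t ∈ I, s ≤ u → u ≤ t →
    ∀ z ∈ openUnitDisk, ω u t (ω s u z) = ω s t z

/-- The family `f l`, `l ∈ S`, is continuous for the topology of locally uniform convergence on
the unit disk: for each `l₀ ∈ S`, `f l → f l₀` locally uniformly as `l → l₀` in `S`. -/
def IsContinuousFamilyOn {L : Type*} [TopologicalSpace L] (S : Set L) (f : L → ℂ → ℂ) : Prop :=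
  ∀ l₀ ∈ S, TendstoLocallyUniformlyOn f (f l₀) (𝓝[S] l₀) openUnitDisk

/-- Joint continuity of `(s, t) ↦ ω s t` on `I_+^2`. -/
def IsJointlyContinuous (I : Set ℝ) (ω : ℝ → ℝ → ℂ → ℂ) : Prop :=
  IsContinuousFamilyOn (orderedPairs I) (fun p => ω p.1 p.2)

/-- Continuity with respect to the left parameter of a family on `[a, b]`: continuity of
`s ↦ ω s b`, with the right parameter fixed at the right end point. -/
def IsLeftContinuousFamily (a b : ℝ) (ω : ℝ → ℝ → ℂ → ℂ) : Prop :=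
  IsContinuousFamilyOn (Icc a b) (fun s => ω s b)

/-- Hyperbolic boundedness: the supremum of `|ω s t 0|` over `I_+^2` is less than `1`. -/
def IsHyperbolicallyBounded (I : Set ℝ) (ω : ℝ → ℝ → ℂ → ℂ) : Prop :=
  ∃ ρ < (1 : ℝ), ∀ s ∈ I, ∀ t ∈ I, s ≤ t → ‖ω s t 0‖ ≤ ρ

/-- The filter on pairs describing `t - s ↘ 0` with `s, t ∈ I` and `s ≤ c ≤ t`. -/
def twoSidedFilter (I : Set ℝ) (c : ℝ) : Filter (ℝ × ℝ) :=
  comap (fun p : ℝ × ℝ => p.2 - p.1) (𝓝[>] 0) ⊓ 𝓟 {p | p ∈ orderedPairs I ∧ p.1 ≤ c ∧ c ≤ p.2}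

/-! ### Families of holomorphic self-maps of the disk -/

/-! Holomorphic self-maps of the disk are locally equicontinuous, and a bound `‖F i 0‖ ≤ ρ < 1`
makes every ultrafilter limit again a self-map. Hence each continuity claim reduces to identifying
ultrafilter limits (`tendsto_of_forall_ultrafilter`), and the composition law supplies the equation
to solve.

From left to joint continuity: a limit φ of ω_{σ,τ} as (σ,τ) → (s,t) satisfies ω_{t,b} ∘ φ = ω_{s,b}
= ω_{t,b} ∘ ω_{s,t}, so univalence of ω_{t,b} forces φ = ω_{s,t}. This univalence is propagated
leftwards from b. It passes to limits by Hurwitz, since no member is constant. If ω_{e,b} is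
univalent, it can be cancelled, so ω_{σ,e} → id as σ ↗ e. For d close to e this gives enough
injectivity to make the family jointly continuous on [d,e], so that ω_{d,e}, and with it ω_{d,b}, is
univalent.

From the condition on derivatives: a limit φ of ω_{σ,τ} at (c,c) fixes 0, and limits h, g of
ω_{σ,b}, ω_{τ,b} satisfy h = g ∘ φ with h'(0) = g'(0) ≠ 0. Thus φ'(0) = 1, and φ = id by the Schwarz
lemma. Convergence to the identity then yields joint continuity
(`isJointlyContinuous_of_tendsto_id`). Conversely, joint continuity gives the bound by compactness,
and nonvanishing derivatives by factoring through maps close to the identity. -/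

/-- Schwarz lemma on the ball of radius `1 - ‖z‖` about `z`, whose image lies within distance 2 of
`f z`. The constant does not depend on `f`, which is equicontinuity. -/
theorem IsHolomorphicSelfMap.dist_le {f : ℂ → ℂ} (hf : IsHolomorphicSelfMap f) {z w : ℂ}
    (hw : dist w z < 1 - ‖z‖) : dist (f w) (f z) ≤ 2 / (1 - ‖z‖) * dist w z := by
  have hsub : Metric.ball z (1 - ‖z‖) ⊆ openUnitDisk := by
    intro x hx
    have h1 : dist x 0 ≤ dist x z + dist z 0 := dist_triangle _ _ _
    rw [dist_zero_right z] at h1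
    exact Metric.mem_ball.2 (by linarith [Metric.mem_ball.1 hx])
  have hz : z ∈ openUnitDisk := by
    have := dist_nonneg (x := w) (y := z)
    rw [mem_ball_zero_iff]
    linarith
  refine Complex.dist_le_div_mul_dist_of_mapsTo_ball (hf.differentiableOn.mono hsub) ?_ hw
  intro x hx
  have h1 := mem_ball_zero_iff.1 (hf.mapsTo (hsub hx))
  have h2 := mem_ball_zero_iff.1 (hf.mapsTo hz)
  rw [Metric.mem_closedBall, dist_eq_norm]
  linarith [norm_sub_le (f x) (f z)]

/-- Holomorphic self-maps of the disk are locally equicontinuous, so pointwise convergence along a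
filter is stable under a perturbation of the argument. -/
theorem tendsto_apply_of_tendsto {ι : Type*} {l : Filter ι} {F : ι → ℂ → ℂ} {u : ι → ℂ} {z w : ℂ}
    (hF : ∀ᶠ i in l, IsHolomorphicSelfMap (F i)) (hz : z ∈ openUnitDisk)
    (hu : Tendsto u l (𝓝 z)) (h : Tendsto (fun i => F i z) l (𝓝 w)) :
    Tendsto (fun i => F i (u i)) l (𝓝 w) := by
  have hz' : 0 < 1 - ‖z‖ := by linarith [mem_ball_zero_iff.1 hz]
  have hd : Tendsto (fun i => dist (u i) z) l (𝓝 0) := tendsto_iff_dist_tendsto_zero.1 hu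
  refine h.congr_dist ?_
  refine squeeze_zero' (Eventually.of_forall fun _ => dist_nonneg) ?_
    (by simpa using hd.const_mul (2 / (1 - ‖z‖)))
  filter_upwards [hF, hd.eventually (gt_mem_nhds hz')] with i hi hi'
  rw [dist_comm]
  exact hi.dist_le hi'

theorem tendstoLocallyUniformlyOn_of_tendsto {ι : Type*} {l : Filter ι} {F : ι → ℂ → ℂ}
    {φ : ℂ → ℂ} (hF : ∀ᶠ i in l, IsHolomorphicSelfMap (F i)) (hφ : ContinuousOn φ openUnitDisk)
    (h : ∀ z ∈ openUnitDisk, Tendsto (fun i => F i z) l (𝓝 (φ z))) :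
    TendstoLocallyUniformlyOn F φ l openUnitDisk := by
  rw [tendstoLocallyUniformlyOn_iff_forall_tendsto]
  intro x hx
  -- Both `φ y` and `F i y` tend to `φ x` as `i` and `y` vary together, so the pair tends to a point
  -- of the diagonal.
  refine Tendsto.mono_right ?_ (nhds_le_uniformity (φ x))
  refine Tendsto.prodMk_nhds ((hφ x hx).tendsto.comp tendsto_snd) ?_
  exact tendsto_apply_of_tendsto (F := fun y : ι × ℂ => F y.1) (u := Prod.snd)
    (tendsto_fst.eventually hF) hx (tendsto_snd.mono_right nhdsWithin_le_nhds)
    ((h x hx).comp tendsto_fst)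

theorem continuousOn_of_tendsto {ι : Type*} {l : Filter ι} [l.NeBot] {F : ι → ℂ → ℂ}
    {φ : ℂ → ℂ} (hF : ∀ᶠ i in l, IsHolomorphicSelfMap (F i))
    (h : ∀ z ∈ openUnitDisk, Tendsto (fun i => F i z) l (𝓝 (φ z))) :
    ContinuousOn φ openUnitDisk := by
  intro z hz
  have hz' : 0 < 1 - ‖z‖ := by linarith [mem_ball_zero_iff.1 hz]
  have hd : Tendsto (fun w => dist w z) (𝓝[openUnitDisk] z) (𝓝 0) :=
    tendsto_iff_dist_tendsto_zero.1 nhdsWithin_le_nhds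
  refine tendsto_iff_dist_tendsto_zero.2 ?_
  refine squeeze_zero' (Eventually.of_forall fun _ => dist_nonneg) ?_
    (by simpa using hd.const_mul (2 / (1 - ‖z‖)))
  filter_upwards [self_mem_nhdsWithin, hd.eventually (gt_mem_nhds hz')] with w hw hw'
  refine le_of_tendsto ((h w hw).dist (h z hz)) ?_
  filter_upwards [hF] with i hi
  exact hi.dist_le hw'

/-- The limit is holomorphic and bounded by 1. Were modulus 1 attained, the maximum principle would
make the limit constant, against `h0`. -/
theorem isHolomorphicSelfMap_of_tendsto {ι : Type*} {l : Filter ι} [l.NeBot] {F : ι → ℂ → ℂ}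
    {φ : ℂ → ℂ} (hF : ∀ᶠ i in l, IsHolomorphicSelfMap (F i))
    (h : ∀ z ∈ openUnitDisk, Tendsto (fun i => F i z) l (𝓝 (φ z))) (h0 : ‖φ 0‖ < 1) :
    IsHolomorphicSelfMap φ := by
  have hd : DifferentiableOn ℂ φ openUnitDisk :=
    (tendstoLocallyUniformlyOn_of_tendsto hF (continuousOn_of_tendsto hF h) h).differentiableOn
      (hF.mono fun i hi => hi.differentiableOn) Metric.isOpen_ball
  have hle : ∀ z ∈ openUnitDisk, ‖φ z‖ ≤ 1 := fun z hz => by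
    refine le_of_tendsto (h z hz).norm ?_
    filter_upwards [hF] with i hi
    exact (mem_ball_zero_iff.1 (hi.mapsTo hz)).le
  refine ⟨hd, fun z hz => ?_⟩
  rw [mem_ball_zero_iff]
  by_contra hz1
  rw [not_lt] at hz1
  have hmax : IsMaxOn (norm ∘ φ) openUnitDisk z := fun w hw => (hle w hw).trans hz1
  have hconst := Complex.eqOn_of_isPreconnected_of_isMaxOn_norm
    (convex_ball (0 : ℂ) 1).isPreconnected Metric.isOpen_ball hd hz hmax
    (Metric.mem_ball_self one_pos)
  rw [hconst] at h0
  exact absurd h0 (not_lt.2 hz1)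

/-! ### Normal families and identification of limits. -/

/-- Montel's theorem for self-maps of the disk, in terms of ultrafilters. -/
theorem Ultrafilter.exists_isHolomorphicSelfMap_tendsto {ι : Type*} (U : Ultrafilter ι)
    {F : ι → ℂ → ℂ} {ρ : ℝ} (hρ : ρ < 1) (hF : ∀ᶠ i in U, IsHolomorphicSelfMap (F i))
    (h0 : ∀ᶠ i in U, ‖F i 0‖ ≤ ρ) :
    ∃ φ, IsHolomorphicSelfMap φ ∧
      ∀ z ∈ openUnitDisk, Tendsto (fun i => F i z) U (𝓝 (φ z)) := by
  have hex : ∀ z : ℂ, ∃ w, z ∈ openUnitDisk → Tendsto (fun i => F i z) U (𝓝 w) := by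
    intro z
    by_cases hz : z ∈ openUnitDisk
    · obtain ⟨w, -, hw⟩ := (isCompact_closedBall (0 : ℂ) 1).ultrafilter_le_nhds
        (U.map fun i => F i z) (by
          rw [le_principal_iff]
          change ∀ᶠ i in U, F i z ∈ Metric.closedBall 0 1
          filter_upwards [hF] with i hi
          exact Metric.ball_subset_closedBall (hi.mapsTo hz))
      exact ⟨w, fun _ => hw⟩
    · exact ⟨0, fun h => absurd h hz⟩
  choose φ hφ using hex
  refine ⟨φ, isHolomorphicSelfMap_of_tendsto hF hφ ?_, hφ⟩
  exact (le_of_tendsto (hφ 0 (Metric.mem_ball_self one_pos)).norm h0).trans_lt hρ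

/-- A family with `‖F i 0‖` bounded away from `1` converges to `ψ` as soon as `ψ` is its only
limit along ultrafilters. -/
theorem tendsto_of_forall_ultrafilter {ι : Type*} {l : Filter ι} {F : ι → ℂ → ℂ} {ψ : ℂ → ℂ}
    {ρ : ℝ} (hρ : ρ < 1) (hF : ∀ᶠ i in l, IsHolomorphicSelfMap (F i))
    (h0 : ∀ᶠ i in l, ‖F i 0‖ ≤ ρ)
    (H : ∀ U : Ultrafilter ι, ↑U ≤ l → ∀ φ, IsHolomorphicSelfMap φ →
      (∀ z ∈ openUnitDisk, Tendsto (fun i => F i z) U (𝓝 (φ z))) → EqOn φ ψ openUnitDisk) :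
    ∀ z ∈ openUnitDisk, Tendsto (fun i => F i z) l (𝓝 (ψ z)) := by
  intro z hz
  rw [tendsto_iff_ultrafilter]
  intro U hU
  obtain ⟨φ, hφ, hlim⟩ := U.exists_isHolomorphicSelfMap_tendsto hρ (hU hF) (hU h0)
  rw [← H U hU φ hφ hlim hz]
  exact hlim z hz

theorem IsHolomorphicSelfMap.analyticOnNhd {f : ℂ → ℂ} (hf : IsHolomorphicSelfMap f) :
    AnalyticOnNhd ℂ f openUnitDisk :=
  hf.differentiableOn.analyticOnNhd Metric.isOpen_ball

theorem IsHolomorphicSelfMap.differentiableAt {f : ℂ → ℂ} (hf : IsHolomorphicSelfMap f) {z : ℂ}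
    (hz : z ∈ openUnitDisk) : DifferentiableAt ℂ f z :=
  hf.differentiableOn.differentiableAt (Metric.isOpen_ball.mem_nhds hz)

theorem IsHolomorphicSelfMap.eqOn_of_eqOn_ball {f g : ℂ → ℂ} (hf : IsHolomorphicSelfMap f)
    (hg : IsHolomorphicSelfMap g) {ε : ℝ} (hε : 0 < ε) (h : EqOn f g (Metric.ball 0 ε)) :
    EqOn f g openUnitDisk :=
  hf.analyticOnNhd.eqOn_of_preconnected_of_eventuallyEq hg.analyticOnNhd
    (convex_ball (0 : ℂ) 1).isPreconnected (Metric.mem_ball_self one_pos)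
    (h.eventuallyEq_of_mem (Metric.ball_mem_nhds _ hε))

theorem IsHolomorphicSelfMap.mapsTo_closedBall {f : ℂ → ℂ} (hf : IsHolomorphicSelfMap f) {ρ : ℝ}
    (h0 : ‖f 0‖ ≤ ρ) :
    MapsTo f (Metric.ball 0 ((1 - ρ) / 4)) (Metric.closedBall 0 ((1 + ρ) / 2)) := by
  intro z hz
  rw [mem_ball_zero_iff] at hz
  have hρ0 : 0 ≤ ρ := (norm_nonneg _).trans h0
  -- This gives `‖f z - f 0‖ ≤ 2‖z‖ < (1 - ρ) / 2`; adding `ρ` yields the radius `(1 + ρ) / 2`.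
  have h1 := hf.dist_le (z := 0) (w := z) (by simp; linarith)
  simp only [norm_zero, sub_zero, div_one, dist_zero_right] at h1
  rw [mem_closedBall_zero_iff]
  rw [dist_eq_norm] at h1
  have h2 := norm_sub_norm_le (f z) (f 0)
  linarith

/-- A self-map fixing the origin with derivative `1` there is the identity. -/
theorem IsHolomorphicSelfMap.eqOn_id {f : ℂ → ℂ} (hf : IsHolomorphicSelfMap f) (h0 : f 0 = 0)
    (h1 : deriv f 0 = 1) : EqOn f id openUnitDisk := by
  have h := Complex.affine_of_mapsTo_ball_of_norm_dslope_eq_div (R₂ := 1) (z₀ := 0)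
    hf.differentiableOn (by rw [h0]; exact hf.mapsTo.mono_right Metric.ball_subset_closedBall)
    (Metric.mem_ball_self one_pos) (by rw [dslope_same, h1]; simp)
  intro z hz
  simpa [h0, h1] using h hz

/-! ### Univalence under limits, and leftward real induction. -/

/-- Derivatives converge uniformly to 1 on the smaller disk. Once they are within 1/2 of 1, `F i -
id` is 1/2-Lipschitz on this convex set, which excludes coincidences. -/
theorem eventually_injOn_of_tendsto_id {ι : Type*} {l : Filter ι} {F : ι → ℂ → ℂ}
    (hF : ∀ᶠ i in l, IsHolomorphicSelfMap (F i))
    (h : ∀ z ∈ openUnitDisk, Tendsto (fun i => F i z) l (𝓝 z)) {R : ℝ} (hR : R < 1) :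
    ∀ᶠ i in l, InjOn (F i) (Metric.closedBall 0 R) ∧
      ∀ z ∈ Metric.closedBall 0 R, deriv (F i) z ≠ 0 := by
  have hsub : Metric.closedBall (0 : ℂ) R ⊆ openUnitDisk := Metric.closedBall_subset_ball hR
  have hlu : TendstoLocallyUniformlyOn F id l openUnitDisk :=
    tendstoLocallyUniformlyOn_of_tendsto hF continuousOn_id h
  have hd := hlu.deriv (hF.mono fun i hi => hi.differentiableOn) Metric.isOpen_ball
  have hu := (tendstoLocallyUniformlyOn_iff_forall_isCompact Metric.isOpen_ball).1 hd _ hsub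
    (isCompact_closedBall _ _)
  rw [Metric.tendstoUniformlyOn_iff] at hu
  filter_upwards [hF, hu (1 / 2) (by norm_num)] with i hi hi'
  have hb : ∀ z ∈ Metric.closedBall (0 : ℂ) R, ‖deriv (F i) z - 1‖ < 1 / 2 := by
    intro z hz
    have := hi' z hz
    rwa [dist_comm, dist_eq_norm, deriv_id] at this
  refine ⟨fun x hx y hy hxy => ?_, fun z hz h0 => ?_⟩
  · have hdf : ∀ z ∈ Metric.closedBall (0 : ℂ) R, HasDerivWithinAt (fun z => F i z - z)
        (deriv (F i) z - 1) (Metric.closedBall (0 : ℂ) R) z := fun z hz =>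
      ((hi.differentiableAt (hsub hz)).hasDerivAt.sub (hasDerivAt_id z)).hasDerivWithinAt
    have hl := (convex_closedBall (0 : ℂ) R).norm_image_sub_le_of_norm_hasDerivWithin_le hdf
      (fun z hz => (hb z hz).le) hx hy
    have he : F i y - y - (F i x - x) = -(y - x) := by rw [hxy]; ring
    rw [he, norm_neg] at hl
    have h0 : ‖y - x‖ = 0 := le_antisymm (by linarith) (norm_nonneg _)
    exact (sub_eq_zero.1 (norm_eq_zero.1 h0)).symm
  · have := hb z hz
    rw [h0] at this
    norm_num at this

/-- Hurwitz's theorem, local form: a value of the limit is attained nearby. -/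
theorem eventually_exists_eq_of_tendsto {ι : Type*} {l : Filter ι} {F : ι → ℂ → ℂ} {φ : ℂ → ℂ}
    (hF : ∀ᶠ i in l, IsHolomorphicSelfMap (F i)) (hinj : ∀ᶠ i in l, InjOn (F i) openUnitDisk)
    (hφ : IsHolomorphicSelfMap φ) (hnc : ¬ ∃ w : ℂ, ∀ z ∈ openUnitDisk, φ z = w)
    (h : ∀ z ∈ openUnitDisk, Tendsto (fun i => F i z) l (𝓝 (φ z))) {x : ℂ}
    (hx : x ∈ openUnitDisk) {V : Set ℂ} (hV : V ∈ 𝓝 x) :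
    ∀ᶠ i in l, ∃ z ∈ V ∩ openUnitDisk, F i z = φ x := by
  have hne : ∀ᶠ z in 𝓝[≠] x, φ z ≠ φ x := by
    refine ((hφ.analyticOnNhd x hx).eventually_eq_or_eventually_ne
      (analyticAt_const (v := φ x))).resolve_left fun hev => hnc ⟨φ x, ?_⟩
    exact hφ.analyticOnNhd.eqOn_of_preconnected_of_eventuallyEq analyticOnNhd_const
      (convex_ball (0 : ℂ) 1).isPreconnected hx hev
  rw [eventually_nhdsWithin_iff] at hne
  obtain ⟨r, hr, hrs⟩ := Metric.nhds_basis_closedBall.mem_iff.1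
    (inter_mem (inter_mem hV (Metric.isOpen_ball.mem_nhds hx)) hne)
  have hrD : Metric.closedBall x r ⊆ openUnitDisk := fun z hz => (hrs hz).1.2
  have hsb : Metric.sphere x r ⊆ Metric.closedBall x r := Metric.sphere_subset_closedBall
  have hcont : ContinuousOn (fun z => ‖φ z - φ x‖) (Metric.sphere x r) :=
    ((hφ.differentiableOn.continuousOn.mono (hsb.trans hrD)).sub continuousOn_const).norm
  obtain ⟨y, hy, hmin⟩ := (isCompact_sphere x r).exists_isMinOn
    (NormedSpace.sphere_nonempty.2 hr.le) hcont
  have hyx : y ≠ x := fun e => by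
    rw [e, Metric.mem_sphere, dist_self] at hy
    exact hr.ne hy
  have hε : 0 < ‖φ y - φ x‖ := norm_pos_iff.2 (sub_ne_zero.2 ((hrs (hsb hy)).2 hyx))
  set ε := ‖φ y - φ x‖ with hεdef
  have hlu := tendstoLocallyUniformlyOn_of_tendsto hF hφ.differentiableOn.continuousOn h
  have hu := (tendstoLocallyUniformlyOn_iff_forall_isCompact Metric.isOpen_ball).1 hlu _ hrD
    (isCompact_closedBall _ _)
  rw [Metric.tendstoUniformlyOn_iff] at hu
  filter_upwards [hF, hinj, hu (ε / 8) (by positivity)] with i hi hij hiu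
  have hux : ‖φ x - F i x‖ < ε / 8 := by
    simpa [dist_eq_norm] using hiu x (Metric.mem_closedBall_self hr.le)
  -- Two errors of ε/8 are lost from ε. The quantitative open mapping theorem then covers the ball
  -- of radius ε/4 about `F i x`, which contains `φ x`.
  have hsphere : ∀ z ∈ Metric.sphere x r, ε / 2 ≤ ‖F i z - F i x‖ := by
    intro z hz
    have h1 : ε ≤ ‖φ z - φ x‖ := hmin hz
    have h2 : ‖φ z - F i z‖ < ε / 8 := by simpa [dist_eq_norm] using hiu z (hsb hz)
    have h3 : φ z - φ x = (φ z - F i z) + (F i z - F i x) - (φ x - F i x) := by ring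
    have h4 := norm_sub_le ((φ z - F i z) + (F i z - F i x)) (φ x - F i x)
    have h5 := norm_add_le (φ z - F i z) (F i z - F i x)
    rw [← h3] at h4
    linarith
  have hfreq : ∃ᶠ z in 𝓝 x, F i z ≠ F i x := by
    have hev : ∀ᶠ z in 𝓝[≠] x, F i z ≠ F i x := by
      filter_upwards [self_mem_nhdsWithin,
        nhdsWithin_le_nhds (Metric.isOpen_ball.mem_nhds hx)] with z hz hzD e
      exact hz (hij hzD hx e)
    exact hev.frequently.filter_mono nhdsWithin_le_nhds
  have hdc : DiffContOnCl ℂ (F i) (Metric.ball x r) :=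
    (hi.differentiableOn.mono hrD).diffContOnCl_ball subset_rfl
  obtain ⟨z, hz, hze⟩ := hdc.ball_subset_image_closedBall hr hsphere hfreq
    (show φ x ∈ Metric.ball (F i x) (ε / 2 / 2) by
      rw [Metric.mem_ball, dist_eq_norm]; linarith)
  exact ⟨z, ⟨(hrs hz).1.1, hrD hz⟩, hze⟩

/-- Hurwitz's theorem: a non-constant limit of univalent functions is univalent. -/
theorem injOn_of_tendsto {ι : Type*} {l : Filter ι} [l.NeBot] {F : ι → ℂ → ℂ} {φ : ℂ → ℂ}
    (hF : ∀ᶠ i in l, IsHolomorphicSelfMap (F i)) (hinj : ∀ᶠ i in l, InjOn (F i) openUnitDisk)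
    (hφ : IsHolomorphicSelfMap φ) (hnc : ¬ ∃ w : ℂ, ∀ z ∈ openUnitDisk, φ z = w)
    (h : ∀ z ∈ openUnitDisk, Tendsto (fun i => F i z) l (𝓝 (φ z))) :
    InjOn φ openUnitDisk := by
  intro x hx y hy hxy
  by_contra hne
  obtain ⟨V, W, hV, hW, hVW⟩ := t2_separation_nhds hne
  obtain ⟨i, hi, ⟨z, hz, hzx⟩, w, hw, hwy⟩ := (hinj.and
    ((eventually_exists_eq_of_tendsto hF hinj hφ hnc h hx hV).and
      (eventually_exists_eq_of_tendsto hF hinj hφ hnc h hy hW))).exists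
  have hzw : z = w := hi hz.2 hw.2 (by rw [hzx, hwy, hxy])
  exact hVW.le_bot ⟨hz.1, hzw ▸ hw.1⟩

/-- The infimum of `B ∩ Icc s t` lies in `B`, and a step further left would contradict minimality
unless it equals `s`. -/
theorem left_mem_of_isClosed {B : Set ℝ} {s t : ℝ} (hst : s ≤ t) (hB : IsClosed (B ∩ Icc s t))
    (ht : t ∈ B) (h : ∀ τ ∈ B ∩ Ioc s t, ∃ σ ∈ Ico s τ, σ ∈ B) : s ∈ B := by
  have hbdd : BddBelow (B ∩ Icc s t) := ⟨s, fun x hx => hx.2.1⟩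
  have hm := hB.csInf_mem ⟨t, ht, hst, le_rfl⟩ hbdd
  rcases eq_or_lt_of_le hm.2.1 with he | hlt
  · rw [he]; exact hm.1
  · obtain ⟨σ, hσ, hσB⟩ := h _ ⟨hm.1, hlt, hm.2.2⟩
    exact absurd (csInf_le hbdd ⟨hσB, hσ.1, hσ.2.le.trans hm.2.2⟩) (not_le.2 hσ.2)

/-! ### Evolution families -/

theorem zero_mem_openUnitDisk : (0 : ℂ) ∈ openUnitDisk := Metric.mem_ball_self one_pos

theorem mem_orderedPairs {I : Set ℝ} {s t : ℝ} (hs : s ∈ I) (ht : t ∈ I) (hst : s ≤ t) :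
    (s, t) ∈ orderedPairs I := ⟨hs, ht, hst⟩

theorem orderedPairs_mono {I J : Set ℝ} (h : J ⊆ I) : orderedPairs J ⊆ orderedPairs I :=
  fun _ hp => ⟨h hp.1, h hp.2.1, hp.2.2⟩

theorem IsEvolutionFamily.mono {I J : Set ℝ} {ω : ℝ → ℝ → ℂ → ℂ} (hω : IsEvolutionFamily I ω)
    (h : J ⊆ I) : IsEvolutionFamily J ω where
  selfMap s hs t ht := hω.selfMap s (h hs) t (h ht)
  nonconstant s hs t ht := hω.nonconstant s (h hs) t (h ht)
  diagonal t ht := hω.diagonal t (h ht)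
  comp s hs u hu t ht := hω.comp s (h hs) u (h hu) t (h ht)

theorem IsEvolutionFamily.isJointlyContinuous_iff {I : Set ℝ} {ω : ℝ → ℝ → ℂ → ℂ}
    (hω : IsEvolutionFamily I ω) :
    IsJointlyContinuous I ω ↔ ∀ p ∈ orderedPairs I, ∀ z ∈ openUnitDisk,
      Tendsto (fun q : ℝ × ℝ => ω q.1 q.2 z) (𝓝[orderedPairs I] p) (𝓝 (ω p.1 p.2 z)) := by
  refine forall₂_congr fun p hp => ⟨fun h z hz => h.tendsto_at hz, fun h => ?_⟩
  refine tendstoLocallyUniformlyOn_of_tendsto ?_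
    (hω.selfMap _ hp.1 _ hp.2.1 hp.2.2).differentiableOn.continuousOn h
  filter_upwards [self_mem_nhdsWithin] with q hq
  exact hω.selfMap _ hq.1 _ hq.2.1 hq.2.2

theorem IsEvolutionFamily.isLeftContinuousFamily_iff {a b : ℝ} {ω : ℝ → ℝ → ℂ → ℂ}
    (hω : IsEvolutionFamily (Icc a b) ω) :
    IsLeftContinuousFamily a b ω ↔ ∀ s ∈ Icc a b, ∀ z ∈ openUnitDisk,
      Tendsto (fun σ => ω σ b z) (𝓝[Icc a b] s) (𝓝 (ω s b z)) := by
  refine forall₂_congr fun s hs => ⟨fun h z hz => h.tendsto_at hz, fun h => ?_⟩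
  have hb : b ∈ Icc a b := right_mem_Icc.2 (hs.1.trans hs.2)
  refine tendstoLocallyUniformlyOn_of_tendsto ?_
    (hω.selfMap _ hs _ hb hs.2).differentiableOn.continuousOn h
  filter_upwards [self_mem_nhdsWithin] with q hq
  exact hω.selfMap _ hq _ hb hq.2

/-! ### Criteria for continuity. -/

/-- Joint continuity of a hyperbolically bounded evolution family follows from convergence to the
identity along intervals shrinking to a point they contain. -/
theorem IsEvolutionFamily.isJointlyContinuous_of_tendsto_id {I : Set ℝ} {ω : ℝ → ℝ → ℂ → ℂ}
    (hω : IsEvolutionFamily I ω) (hb : IsHyperbolicallyBounded I ω)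
    (H : ∀ c ∈ I, ∀ z ∈ openUnitDisk, Tendsto (fun p : ℝ × ℝ => ω p.1 p.2 z)
      (𝓝[{p | p ∈ orderedPairs I ∧ p.1 < p.2 ∧ p.1 ≤ c ∧ c ≤ p.2}] (c, c)) (𝓝 z)) :
    IsJointlyContinuous I ω := by
  obtain ⟨ρ, hρ, hb⟩ := hb
  have H' : ∀ {ι : Type} {l : Filter ι} {u v : ι → ℝ} {c : ℝ} {z : ℂ}, c ∈ I → z ∈ openUnitDisk →
      Tendsto u l (𝓝 c) → Tendsto v l (𝓝 c) →
      (∀ᶠ i in l, (u i, v i) ∈ orderedPairs I ∧ (u i = v i ∨ u i ≤ c ∧ c ≤ v i)) →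
      Tendsto (fun i => ω (u i) (v i) z) l (𝓝 z) := by
    intro ι l u v c z hc hz hu hv huv
    have hdiag : Tendsto (fun p : ℝ × ℝ => ω p.1 p.2 z)
        (𝓝[{p | p ∈ orderedPairs I ∧ p.1 = p.2}] (c, c)) (𝓝 z) := by
      refine tendsto_const_nhds.congr' ?_
      filter_upwards [self_mem_nhdsWithin] with p hp
      rw [← hp.2, hω.diagonal _ hp.1.1 _ hz]
    have hunion := (H c hc z hz).sup hdiag
    rw [← nhdsWithin_union] at hunion
    refine hunion.comp (f := fun i => (u i, v i)) (tendsto_nhdsWithin_iff.2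
      ⟨hu.prodMk_nhds hv, ?_⟩)
    filter_upwards [huv] with i hi
    rcases eq_or_lt_of_le hi.1.2.2 with he | hlt
    · exact Or.inr ⟨hi.1, he⟩
    · exact Or.inl ⟨hi.1, hlt, hi.2.resolve_left hlt.ne⟩
  rw [hω.isJointlyContinuous_iff]
  rintro ⟨s, t⟩ ⟨hs, ht, hst⟩
  change s ∈ I at hs
  change t ∈ I at ht
  change s ≤ t at hst
  refine tendsto_of_forall_ultrafilter hρ (l := 𝓝[orderedPairs I] (s, t)) ?_ ?_ ?_
  · filter_upwards [self_mem_nhdsWithin] with p hp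
    exact hω.selfMap _ hp.1 _ hp.2.1 hp.2.2
  · filter_upwards [self_mem_nhdsWithin] with p hp
    exact hb _ hp.1 _ hp.2.1 hp.2.2
  intro U hU φ hφ hlim z hz
  have hmem : ∀ᶠ p in (U : Filter (ℝ × ℝ)), p ∈ orderedPairs I := hU self_mem_nhdsWithin
  have hnhds : Tendsto id (U : Filter (ℝ × ℝ)) (𝓝 (s, t)) := hU.trans nhdsWithin_le_nhds
  have hfst : Tendsto Prod.fst (U : Filter (ℝ × ℝ)) (𝓝 s) :=
    (continuous_fst.tendsto (s, t)).comp hnhds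
  have hsnd : Tendsto Prod.snd (U : Filter (ℝ × ℝ)) (𝓝 t) :=
    (continuous_snd.tendsto (s, t)).comp hnhds
  -- Enlarge both time intervals to their hull [min(p.1,s), max(p.2,t)]. The map of the hull factors
  -- through `ω p.1 p.2` and through `ω s t`; in each case the outer factors belong to intervals
  -- that are degenerate or contain `s`, respectively `t`, so they tend to the identity.
  have hmin : Tendsto (fun p : ℝ × ℝ => min p.1 s) U (𝓝 s) := by
    simpa using hfst.min (tendsto_const_nhds (x := s))
  have hmax : Tendsto (fun p : ℝ × ℝ => max p.2 t) U (𝓝 t) := by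
    simpa using hsnd.max (tendsto_const_nhds (x := t))
  have hminI : ∀ {p : ℝ × ℝ}, p ∈ orderedPairs I → min p.1 s ∈ I := fun {p} hp => by
    rcases min_choice p.1 s with h | h <;> rw [h]
    exacts [hp.1, hs]
  have hmaxI : ∀ {p : ℝ × ℝ}, p ∈ orderedPairs I → max p.2 t ∈ I := fun {p} hp => by
    rcases max_choice p.2 t with h | h <;> rw [h]
    exacts [hp.2.1, ht]
  have h1 : Tendsto (fun p : ℝ × ℝ => ω (min p.1 s) p.1 z) U (𝓝 z) := by
    refine H' hs hz hmin hfst ?_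
    filter_upwards [hmem] with p hp
    refine ⟨mem_orderedPairs (hminI hp) hp.1 (min_le_left _ _), ?_⟩
    rcases le_total p.1 s with h | h
    · exact Or.inl (min_eq_left h)
    · exact Or.inr ⟨min_le_right _ _, h⟩
  have h2 : Tendsto (fun p : ℝ × ℝ => ω (min p.1 s) s z) U (𝓝 z) := by
    refine H' hs hz hmin tendsto_const_nhds ?_
    filter_upwards [hmem] with p hp
    exact ⟨mem_orderedPairs (hminI hp) hs (min_le_right _ _), Or.inr ⟨min_le_right _ _, le_rfl⟩⟩
  have h3 : ∀ w ∈ openUnitDisk, Tendsto (fun p : ℝ × ℝ => ω p.2 (max p.2 t) w) U (𝓝 w) := by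
    intro w hw
    refine H' ht hw hsnd hmax ?_
    filter_upwards [hmem] with p hp
    refine ⟨mem_orderedPairs hp.2.1 (hmaxI hp) (le_max_left _ _), ?_⟩
    rcases le_total p.2 t with h | h
    · exact Or.inr ⟨h, le_max_right _ _⟩
    · exact Or.inl (max_eq_left h).symm
  have h4 : ∀ w ∈ openUnitDisk, Tendsto (fun p : ℝ × ℝ => ω t (max p.2 t) w) U (𝓝 w) := by
    intro w hw
    refine H' ht hw tendsto_const_nhds hmax ?_
    filter_upwards [hmem] with p hp
    exact ⟨mem_orderedPairs ht (hmaxI hp) (le_max_right _ _), Or.inr ⟨le_rfl, le_max_right _ _⟩⟩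
  have hst' := hω.selfMap _ hs _ ht hst
  have h5 : Tendsto (fun p : ℝ × ℝ => ω p.1 p.2 (ω (min p.1 s) p.1 z)) U (𝓝 (φ z)) := by
    refine tendsto_apply_of_tendsto (F := fun p : ℝ × ℝ => ω p.1 p.2) ?_ hz h1 (hlim z hz)
    filter_upwards [hmem] with p hp
    exact hω.selfMap _ hp.1 _ hp.2.1 hp.2.2
  have h6 : Tendsto (fun p : ℝ × ℝ => ω p.2 (max p.2 t) (ω p.1 p.2 (ω (min p.1 s) p.1 z))) U
      (𝓝 (φ z)) := by
    refine tendsto_apply_of_tendsto (F := fun p : ℝ × ℝ => ω p.2 (max p.2 t)) ?_ (hφ.mapsTo hz) h5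
      (h3 _ (hφ.mapsTo hz))
    filter_upwards [hmem] with p hp
    exact hω.selfMap _ hp.2.1 _ (hmaxI hp) (le_max_left _ _)
  have h7 : Tendsto (fun p : ℝ × ℝ => ω s t (ω (min p.1 s) s z)) U (𝓝 (ω s t z)) :=
    tendsto_apply_of_tendsto (F := fun _ : ℝ × ℝ => ω s t) (Eventually.of_forall fun _ => hst') hz
      h2 tendsto_const_nhds
  have h8 : Tendsto (fun p : ℝ × ℝ => ω t (max p.2 t) (ω s t (ω (min p.1 s) s z))) U
      (𝓝 (ω s t z)) := by
    refine tendsto_apply_of_tendsto (F := fun p : ℝ × ℝ => ω t (max p.2 t)) ?_ (hst'.mapsTo hz) h7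
      (h4 _ (hst'.mapsTo hz))
    filter_upwards [hmem] with p hp
    exact hω.selfMap _ ht _ (hmaxI hp) (le_max_right _ _)
  refine tendsto_nhds_unique_of_eventuallyEq h6 h8 ?_
  filter_upwards [hmem] with p hp
  have hm := hminI hp
  have hM := hmaxI hp
  have hp12 := hp.2.2
  rw [hω.comp _ hm _ hp.1 _ hp.2.1 (min_le_left _ _) hp12 _ hz,
    hω.comp _ hm _ hp.2.1 _ hM ((min_le_left _ _).trans hp12) (le_max_left _ _) _ hz,
    hω.comp _ hm _ hs _ ht (min_le_right _ _) hst _ hz,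
    hω.comp _ hm _ ht _ hM ((min_le_right _ _).trans hst) (le_max_right _ _) _ hz]

/-- If `s ↦ ω s e` is continuous and every `ω t e` is univalent on a large enough disk, then the
family is jointly continuous. -/
theorem IsEvolutionFamily.isJointlyContinuous_of_injOn_closedBall {d e ρ : ℝ} {ω : ℝ → ℝ → ℂ → ℂ}
    (hω : IsEvolutionFamily (Icc d e) ω) (hρ : ρ < 1)
    (hb : ∀ s ∈ Icc d e, ∀ t ∈ Icc d e, s ≤ t → ‖ω s t 0‖ ≤ ρ)
    (hl : ∀ s ∈ Icc d e, ∀ z ∈ openUnitDisk,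
      Tendsto (fun σ => ω σ e z) (𝓝[Icc d e] s) (𝓝 (ω s e z)))
    (hinj : ∀ t ∈ Icc d e, InjOn (ω t e) (Metric.closedBall 0 ((1 + ρ) / 2))) :
    IsJointlyContinuous (Icc d e) ω := by
  rw [hω.isJointlyContinuous_iff]
  rintro ⟨s, t⟩ ⟨hs, ht, hst⟩
  change s ∈ Icc d e at hs
  change t ∈ Icc d e at ht
  change s ≤ t at hst
  have he : e ∈ Icc d e := right_mem_Icc.2 (hs.1.trans hs.2)
  refine tendsto_of_forall_ultrafilter hρ (l := 𝓝[orderedPairs (Icc d e)] (s, t)) ?_ ?_ ?_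
  · filter_upwards [self_mem_nhdsWithin] with p hp
    exact hω.selfMap _ hp.1 _ hp.2.1 hp.2.2
  · filter_upwards [self_mem_nhdsWithin] with p hp
    exact hb _ hp.1 _ hp.2.1 hp.2.2
  intro U hU φ hφ hlim
  have hmem : ∀ᶠ p in (U : Filter (ℝ × ℝ)), p ∈ orderedPairs (Icc d e) := hU self_mem_nhdsWithin
  have hnhds : Tendsto id (U : Filter (ℝ × ℝ)) (𝓝 (s, t)) := hU.trans nhdsWithin_le_nhds
  have hfst : Tendsto Prod.fst (U : Filter (ℝ × ℝ)) (𝓝[Icc d e] s) :=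
    tendsto_nhdsWithin_iff.2 ⟨(continuous_fst.tendsto (s, t)).comp hnhds, hmem.mono fun p hp => hp.1⟩
  have hsnd : Tendsto Prod.snd (U : Filter (ℝ × ℝ)) (𝓝[Icc d e] t) :=
    tendsto_nhdsWithin_iff.2
      ⟨(continuous_snd.tendsto (s, t)).comp hnhds, hmem.mono fun p hp => hp.2.1⟩
  have hst' := hω.selfMap _ hs _ ht hst
  have hφ0 : ‖φ 0‖ ≤ ρ := by
    refine le_of_tendsto (hlim 0 zero_mem_openUnitDisk).norm ?_
    filter_upwards [hmem] with p hp
    exact hb _ hp.1 _ hp.2.1 hp.2.2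
  -- On this small ball both maps take values where `ω t e` is injective; the identity theorem does
  -- the rest.
  refine hφ.eqOn_of_eqOn_ball hst' (ε := (1 - ρ) / 4) (by linarith) fun z hz => ?_
  have hzD : z ∈ openUnitDisk := by
    have hρ0 := (norm_nonneg _).trans hφ0
    rw [mem_ball_zero_iff] at hz ⊢
    linarith
  refine hinj t ht (hφ.mapsTo_closedBall hφ0 hz)
    (hst'.mapsTo_closedBall (hb _ hs _ ht hst) hz) ?_
  rw [hω.comp _ hs _ ht _ he hst ht.2 _ hzD]
  have h1 : Tendsto (fun p : ℝ × ℝ => ω p.2 e (ω p.1 p.2 z)) U (𝓝 (ω t e (φ z))) := by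
    refine tendsto_apply_of_tendsto (F := fun p : ℝ × ℝ => ω p.2 e) ?_ (hφ.mapsTo hzD)
      (hlim z hzD) ((hl t ht _ (hφ.mapsTo hzD)).comp hsnd)
    filter_upwards [hmem] with p hp
    exact hω.selfMap _ hp.2.1 _ he hp.2.1.2
  refine tendsto_nhds_unique_of_eventuallyEq h1 ((hl s hs z hzD).comp hfst) ?_
  filter_upwards [hmem] with p hp
  exact hω.comp _ hp.1 _ hp.2.1 _ he hp.2.2 hp.2.1.2 _ hzD

/-- A limit φ of `ω σ e` has the same composition with `ω e b` as `ω s e` has, and `ω e b` can be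
cancelled. This moves the right end point from `b` to `e`. -/
theorem IsEvolutionFamily.tendsto_left_of_injOn {a b ρ e : ℝ} {ω : ℝ → ℝ → ℂ → ℂ}
    (hω : IsEvolutionFamily (Icc a b) ω) (hρ : ρ < 1)
    (hb : ∀ s ∈ Icc a b, ∀ t ∈ Icc a b, s ≤ t → ‖ω s t 0‖ ≤ ρ)
    (hl : ∀ s ∈ Icc a b, ∀ z ∈ openUnitDisk,
      Tendsto (fun σ => ω σ b z) (𝓝[Icc a b] s) (𝓝 (ω s b z)))
    (he : e ∈ Icc a b) (hinj : InjOn (ω e b) openUnitDisk) {s : ℝ} (hs : s ∈ Icc a e) :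
    ∀ z ∈ openUnitDisk, Tendsto (fun σ => ω σ e z) (𝓝[Icc a e] s) (𝓝 (ω s e z)) := by
  have hsub : Icc a e ⊆ Icc a b := Icc_subset_Icc_right he.2
  have hbI : b ∈ Icc a b := right_mem_Icc.2 (he.1.trans he.2)
  have heb := hω.selfMap _ he _ hbI he.2
  have hse := hω.selfMap _ (hsub hs) _ he hs.2
  refine tendsto_of_forall_ultrafilter hρ (l := 𝓝[Icc a e] s) ?_ ?_ ?_
  · filter_upwards [self_mem_nhdsWithin] with σ hσ
    exact hω.selfMap _ (hsub hσ) _ he hσ.2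
  · filter_upwards [self_mem_nhdsWithin] with σ hσ
    exact hb _ (hsub hσ) _ he hσ.2
  intro U hU φ hφ hlim z hz
  have hmem : ∀ᶠ σ in (U : Filter ℝ), σ ∈ Icc a e := hU self_mem_nhdsWithin
  refine hinj (hφ.mapsTo hz) (hse.mapsTo hz) ?_
  rw [hω.comp _ (hsub hs) _ he _ hbI hs.2 he.2 _ hz]
  have h1 : Tendsto (fun σ => ω e b (ω σ e z)) U (𝓝 (ω e b (φ z))) :=
    tendsto_apply_of_tendsto (F := fun _ : ℝ => ω e b) (Eventually.of_forall fun _ => heb)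
      (hφ.mapsTo hz) (hlim z hz) tendsto_const_nhds
  refine tendsto_nhds_unique_of_eventuallyEq h1
    ((hl s (hsub hs) z hz).mono_left (hU.trans (nhdsWithin_mono _ hsub))) ?_
  filter_upwards [hmem] with σ hσ
  exact hω.comp _ (hsub hσ) _ he _ hbI hσ.2 he.2 _ hz

/-! ### Univalence and nonvanishing derivative from joint continuity. -/

section JointlyContinuous

variable {d e : ℝ} {ω : ℝ → ℝ → ℂ → ℂ}

theorem IsEvolutionFamily.tendsto_right (hω : IsEvolutionFamily (Icc d e) ω)
    (hc : IsJointlyContinuous (Icc d e) ω) {τ : ℝ} (hτ : τ ∈ Icc d e) {z : ℂ}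
    (hz : z ∈ openUnitDisk) :
    Tendsto (fun σ => ω d σ z) (𝓝[Icc d e] τ) (𝓝 (ω d τ z)) := by
  have hd : d ∈ Icc d e := left_mem_Icc.2 (hτ.1.trans hτ.2)
  refine (hω.isJointlyContinuous_iff.1 hc (d, τ) (mem_orderedPairs hd hτ hτ.1) z hz).comp
    (f := fun σ => (d, σ)) (tendsto_nhdsWithin_iff.2
      ⟨tendsto_const_nhds.prodMk_nhds nhdsWithin_le_nhds, ?_⟩)
  filter_upwards [self_mem_nhdsWithin] with σ hσ
  exact mem_orderedPairs hd hσ hσ.1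

/-- Over short times before `τ`, the maps of a jointly continuous evolution family are univalent on
a given smaller disk. -/
theorem IsEvolutionFamily.eventually_injOn (hω : IsEvolutionFamily (Icc d e) ω)
    (hc : IsJointlyContinuous (Icc d e) ω) {τ : ℝ} (hτ : τ ∈ Ioc d e) {R : ℝ} (hR : R < 1) :
    ∀ᶠ σ in 𝓝[Ico d τ] τ, InjOn (ω σ τ) (Metric.closedBall 0 R) ∧
      ∀ z ∈ Metric.closedBall 0 R, deriv (ω σ τ) z ≠ 0 := by
  have hτ' : τ ∈ Icc d e := Ioc_subset_Icc_self hτ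
  have hmem : ∀ᶠ σ in 𝓝[Ico d τ] τ, (σ, τ) ∈ orderedPairs (Icc d e) := by
    filter_upwards [self_mem_nhdsWithin] with σ hσ
    exact mem_orderedPairs ⟨hσ.1, hσ.2.le.trans hτ.2⟩ hτ' hσ.2.le
  refine eventually_injOn_of_tendsto_id (F := fun σ => ω σ τ) ?_ (fun z hz => ?_) hR
  · filter_upwards [hmem] with σ hσ
    exact hω.selfMap _ hσ.1 _ hσ.2.1 hσ.2.2
  · have h := (hω.isJointlyContinuous_iff.1 hc (τ, τ) (mem_orderedPairs hτ' hτ' le_rfl) z hz).comp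
      (f := fun σ => (σ, τ)) (tendsto_nhdsWithin_iff.2
        ⟨(tendsto_id'.2 nhdsWithin_le_nhds).prodMk_nhds tendsto_const_nhds, hmem⟩)
    rwa [hω.diagonal _ hτ' _ hz] at h

theorem IsEvolutionFamily.eventually_mem_closedBall (hω : IsEvolutionFamily (Icc d e) ω)
    (hc : IsJointlyContinuous (Icc d e) ω) {τ : ℝ} (hτ : τ ∈ Ioc d e) {z : ℂ}
    (hz : z ∈ openUnitDisk) {R : ℝ} (hR : ‖ω d τ z‖ < R) :
    ∀ᶠ σ in 𝓝[Ico d τ] τ, ω d σ z ∈ Metric.closedBall 0 R := by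
  have h := (hω.tendsto_right hc (Ioc_subset_Icc_self hτ) hz).mono_left
    (nhdsWithin_mono τ (show Ico d τ ⊆ Icc d e from fun x hx => ⟨hx.1, hx.2.le.trans hτ.2⟩))
  filter_upwards [h.norm.eventually (gt_mem_nhds hR)] with σ hσ
  exact mem_closedBall_zero_iff.2 hσ.le

theorem neBot_nhdsWithin_Ico_right {d τ : ℝ} (h : d < τ) : (𝓝[Ico d τ] τ).NeBot :=
  mem_closure_iff_nhdsWithin_neBot.1 (by rw [closure_Ico h.ne]; exact right_mem_Icc.2 h.le)

/-- Trajectories that meet at time τ met slightly earlier, because `ω σ τ` is injective on a disk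
containing both of them. Leftward induction carries the coincidence back to time `d`, where the map
is the identity. -/
theorem IsEvolutionFamily.injOn_of_isJointlyContinuous (hω : IsEvolutionFamily (Icc d e) ω)
    (hde : d ≤ e) (hc : IsJointlyContinuous (Icc d e) ω) : InjOn (ω d e) openUnitDisk := by
  intro x hx y hy hxy
  have hd : d ∈ Icc d e := left_mem_Icc.2 hde
  have hcont : ∀ z ∈ openUnitDisk, ContinuousOn (fun σ => ω d σ z) (Icc d e) :=
    fun z hz τ hτ => hω.tendsto_right hc hτ hz
  have hclosed : IsClosed ({τ | ω d τ x = ω d τ y} ∩ Icc d e) := by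
    have := ((hcont x hx).sub (hcont y hy)).preimage_isClosed_of_isClosed isClosed_Icc
      (isClosed_singleton (x := (0 : ℂ)))
    rw [inter_comm]
    convert this using 2
    ext τ
    simp [sub_eq_zero]
  have hmem := left_mem_of_isClosed hde hclosed hxy fun τ hτ => by
    have hne := neBot_nhdsWithin_Ico_right hτ.2.1
    have hτ' := Ioc_subset_Icc_self hτ.2
    have h1 : ‖ω d τ x‖ < 1 := mem_ball_zero_iff.1 ((hω.selfMap _ hd _ hτ' hτ'.1).mapsTo hx)
    obtain ⟨R, hR, hR1⟩ := exists_between h1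
    have hxyτ : ω d τ x = ω d τ y := hτ.1
    obtain ⟨σ, hσ, hi, hσx, hσy⟩ := (eventually_mem_nhdsWithin.and
      ((hω.eventually_injOn hc hτ.2 hR1).and ((hω.eventually_mem_closedBall hc hτ.2 hx hR).and
        (hω.eventually_mem_closedBall hc hτ.2 hy (hxyτ ▸ hR))))).exists
    have hσ' : σ ∈ Icc d e := ⟨hσ.1, hσ.2.le.trans hτ'.2⟩
    refine ⟨σ, hσ, hi.1 hσx hσy ?_⟩
    rw [hω.comp _ hd _ hσ' _ hτ' hσ.1 hσ.2.le _ hx, hω.comp _ hd _ hσ' _ hτ' hσ.1 hσ.2.le _ hy]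
    exact hxyτ
  change ω d d x = ω d d y at hmem
  rwa [hω.diagonal _ hd _ hx, hω.diagonal _ hd _ hy] at hmem

theorem IsEvolutionFamily.deriv_comp (hω : IsEvolutionFamily (Icc d e) ω) {s u t : ℝ}
    (hs : s ∈ Icc d e) (hu : u ∈ Icc d e) (ht : t ∈ Icc d e) (hsu : s ≤ u) (hut : u ≤ t) {z : ℂ}
    (hz : z ∈ openUnitDisk) :
    deriv (ω s t) z = deriv (ω u t) (ω s u z) * deriv (ω s u) z := by
  have hsm := hω.selfMap _ hs _ hu hsu
  have hev : ω s t =ᶠ[𝓝 z] ω u t ∘ ω s u := by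
    filter_upwards [Metric.isOpen_ball.mem_nhds hz] with w hw
    exact (hω.comp _ hs _ hu _ ht hsu hut _ hw).symm
  rw [hev.deriv_eq, _root_.deriv_comp]
  · exact (hω.selfMap _ hu _ ht hut).differentiableAt (hsm.mapsTo hz)
  · exact hsm.differentiableAt hz

theorem IsEvolutionFamily.deriv_ne_zero_of_isJointlyContinuous
    (hω : IsEvolutionFamily (Icc d e) ω) (hde : d ≤ e) (hc : IsJointlyContinuous (Icc d e) ω)
    {z : ℂ} (hz : z ∈ openUnitDisk) : deriv (ω d e) z ≠ 0 := by
  intro h0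
  have hd : d ∈ Icc d e := left_mem_Icc.2 hde
  have hcont : ContinuousOn (fun σ => deriv (ω d σ) z) (Icc d e) := by
    intro τ hτ
    have hlu : TendstoLocallyUniformlyOn (fun σ => ω d σ) (ω d τ) (𝓝[Icc d e] τ) openUnitDisk := by
      refine tendstoLocallyUniformlyOn_of_tendsto ?_
        (hω.selfMap _ hd _ hτ hτ.1).differentiableOn.continuousOn
        fun z hz => hω.tendsto_right hc hτ hz
      filter_upwards [self_mem_nhdsWithin] with σ hσ
      exact hω.selfMap _ hd _ hσ hσ.1
    refine (hlu.deriv ?_ Metric.isOpen_ball).tendsto_at hz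
    filter_upwards [self_mem_nhdsWithin] with σ hσ
    exact (hω.selfMap _ hd _ hσ hσ.1).differentiableOn
  have hclosed : IsClosed ({τ | deriv (ω d τ) z = 0} ∩ Icc d e) := by
    rw [inter_comm]
    exact hcont.preimage_isClosed_of_isClosed isClosed_Icc (isClosed_singleton (x := (0 : ℂ)))
  -- By the chain rule through a nearby σ, whose factor `deriv (ω σ τ)` does not vanish, a zero at τ
  -- comes from a zero at σ.
  have hmem := left_mem_of_isClosed hde hclosed h0 fun τ hτ => by
    have hne := neBot_nhdsWithin_Ico_right hτ.2.1
    have hτ' := Ioc_subset_Icc_self hτ.2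
    have h1 : ‖ω d τ z‖ < 1 := mem_ball_zero_iff.1 ((hω.selfMap _ hd _ hτ' hτ'.1).mapsTo hz)
    obtain ⟨R, hR, hR1⟩ := exists_between h1
    obtain ⟨σ, hσ, hi, hσz⟩ := (eventually_mem_nhdsWithin.and
      ((hω.eventually_injOn hc hτ.2 hR1).and
        (hω.eventually_mem_closedBall hc hτ.2 hz hR))).exists
    have hσ' : σ ∈ Icc d e := ⟨hσ.1, hσ.2.le.trans hτ'.2⟩
    refine ⟨σ, hσ, ?_⟩
    have hτ0 : deriv (ω d τ) z = 0 := hτ.1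
    rw [hω.deriv_comp hd hσ' hτ' hσ.1 hσ.2.le hz] at hτ0
    exact (mul_eq_zero.1 hτ0).resolve_left (hi.2 _ hσz)
  have hev : ω d d =ᶠ[𝓝 z] id := by
    filter_upwards [Metric.isOpen_ball.mem_nhds hz] with w hw
    exact hω.diagonal _ hd _ hw
  change deriv (ω d d) z = 0 at hmem
  rw [hev.deriv_eq, deriv_id] at hmem
  exact one_ne_zero hmem

end JointlyContinuous

/-! ### From left continuity to joint continuity. -/

/-- In a hyperbolically bounded evolution family that is continuous in the left parameter, every
`ω s b` is univalent. -/
theorem IsEvolutionFamily.injOn_of_isLeftContinuousFamily {a b : ℝ} {ω : ℝ → ℝ → ℂ → ℂ}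
    (hω : IsEvolutionFamily (Icc a b) ω) (hb : IsHyperbolicallyBounded (Icc a b) ω)
    (hl : IsLeftContinuousFamily a b ω) {s : ℝ} (hs : s ∈ Icc a b) :
    InjOn (ω s b) openUnitDisk := by
  obtain ⟨ρ, hρ, hb⟩ := hb
  rw [hω.isLeftContinuousFamily_iff] at hl
  have hbI : b ∈ Icc a b := right_mem_Icc.2 (hs.1.trans hs.2)
  have hsb : Icc s b ⊆ Icc a b := Icc_subset_Icc_left hs.1
  refine left_mem_of_isClosed (B := {c | InjOn (ω c b) openUnitDisk}) hs.2 ?_ ?_ ?_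
  · refine isClosed_of_closure_subset fun c hc => ?_
    have hcI : c ∈ Icc s b := closure_minimal inter_subset_right isClosed_Icc hc
    have := mem_closure_iff_nhdsWithin_neBot.1 hc
    refine ⟨?_, hcI⟩
    refine injOn_of_tendsto (l := 𝓝[{c | InjOn (ω c b) openUnitDisk} ∩ Icc s b] c)
      (F := fun σ => ω σ b) ?_ ?_ (hω.selfMap _ (hsb hcI) _ hbI hcI.2)
      (hω.nonconstant _ (hsb hcI) _ hbI hcI.2)
      fun z hz => (hl c (hsb hcI) z hz).mono_left
        (nhdsWithin_mono c (inter_subset_right.trans hsb))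
    · filter_upwards [self_mem_nhdsWithin] with σ hσ
      exact hω.selfMap _ (hsb hσ.2) _ hbI hσ.2.2
    · filter_upwards [self_mem_nhdsWithin] with σ hσ
      exact hσ.1
  · intro x hx y hy hxy
    rwa [hω.diagonal _ hbI _ hx, hω.diagonal _ hbI _ hy] at hxy
  · rintro e ⟨hinj, he⟩
    have heI : e ∈ Icc a b := hsb (Ioc_subset_Icc_self he)
    have hae : e ∈ Icc a e := right_mem_Icc.2 heI.1
    have hle : ∀ σ ∈ Icc a e, ∀ z ∈ openUnitDisk,
        Tendsto (fun σ => ω σ e z) (𝓝[Icc a e] σ) (𝓝 (ω σ e z)) :=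
      fun σ hσ => hω.tendsto_left_of_injOn hρ hb hl heI hinj hσ
    have hR : (1 + ρ) / 2 < 1 := by linarith
    have hev := eventually_injOn_of_tendsto_id (F := fun σ => ω σ e) (l := 𝓝[Icc a e] e)
      (by
        filter_upwards [self_mem_nhdsWithin] with σ hσ
        exact hω.selfMap _ ⟨hσ.1, hσ.2.trans heI.2⟩ _ heI hσ.2)
      (fun z hz => by simpa only [hω.diagonal _ heI _ hz] using hle e hae z hz) hR
    obtain ⟨δ, hδ, hball⟩ := Metric.mem_nhdsWithin_iff.1 hev
    -- Beyond `e - δ` every `ω τ e` is injective on the disk of radius `(1 + ρ) / 2`, so joint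
    -- continuity holds on all of `Icc d e`.
    obtain ⟨d, hd1, hd2⟩ := exists_between (max_lt he.1 (sub_lt_self e hδ))
    have hsd : s ≤ d := ((le_max_left _ _).trans_lt hd1).le
    have hed : e - δ < d := (le_max_right _ _).trans_lt hd1
    have hde : Icc d e ⊆ Icc a e := Icc_subset_Icc_left (hs.1.trans hsd)
    have hdeI : Icc d e ⊆ Icc a b := hde.trans (Icc_subset_Icc_right heI.2)
    have hωde := hω.mono hdeI
    have hjc := hωde.isJointlyContinuous_of_injOn_closedBall hρ
      (fun σ hσ τ hτ h => hb σ (hdeI hσ) τ (hdeI hτ) h)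
      (fun σ hσ z hz => (hle σ (hde hσ) z hz).mono_left (nhdsWithin_mono σ hde))
      (fun τ hτ => (hball ⟨by
        rw [Metric.mem_ball, Real.dist_eq, abs_lt]
        constructor <;> linarith [hτ.1, hτ.2], hde hτ⟩).1)
    have hinj' := hωde.injOn_of_isJointlyContinuous hd2.le hjc
    have hdI : d ∈ Icc a b := hdeI (left_mem_Icc.2 hd2.le)
    refine ⟨d, ⟨hsd, hd2⟩, fun x hx y hy hxy => hinj' hx hy ?_⟩
    have hsm := hω.selfMap _ hdI _ heI hd2.le
    refine hinj (hsm.mapsTo hx) (hsm.mapsTo hy) ?_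
    rw [hω.comp _ hdI _ heI _ hbI hd2.le heI.2 _ hx, hω.comp _ hdI _ heI _ hbI hd2.le heI.2 _ hy,
      hxy]

theorem IsEvolutionFamily.isJointlyContinuous_of_isLeftContinuousFamily {a b : ℝ}
    {ω : ℝ → ℝ → ℂ → ℂ} (hω : IsEvolutionFamily (Icc a b) ω)
    (hb : IsHyperbolicallyBounded (Icc a b) ω) (hl : IsLeftContinuousFamily a b ω) :
    IsJointlyContinuous (Icc a b) ω := by
  have hinj := fun s hs => hω.injOn_of_isLeftContinuousFamily hb hl (s := s) hs
  obtain ⟨ρ, hρ, hb⟩ := hb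
  exact hω.isJointlyContinuous_of_injOn_closedBall hρ hb (hω.isLeftContinuousFamily_iff.1 hl)
    fun t ht => (hinj t ht).mono (Metric.closedBall_subset_ball (by linarith))

/-! ### Consequences of joint continuity, and the derivative criterion. -/

theorem IsEvolutionFamily.isHyperbolicallyBounded {a b : ℝ} {ω : ℝ → ℝ → ℂ → ℂ}
    (hω : IsEvolutionFamily (Icc a b) ω) (hc : IsJointlyContinuous (Icc a b) ω) :
    IsHyperbolicallyBounded (Icc a b) ω := by
  have hcomp : IsCompact (orderedPairs (Icc a b)) := by
    have : orderedPairs (Icc a b) = Icc a b ×ˢ Icc a b ∩ {p | p.1 ≤ p.2} := by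
      ext p
      simp only [orderedPairs, mem_ofPred_eq, mem_inter_iff, mem_prod, and_assoc]
    rw [this]
    exact (isCompact_Icc.prod isCompact_Icc).inter_right (isClosed_le continuous_fst continuous_snd)
  have hcont : ContinuousOn (fun p : ℝ × ℝ => ‖ω p.1 p.2 0‖) (orderedPairs (Icc a b)) :=
    fun p hp => (hω.isJointlyContinuous_iff.1 hc p hp 0 zero_mem_openUnitDisk).norm
  rcases (orderedPairs (Icc a b)).eq_empty_or_nonempty with he | hne
  · refine ⟨0, one_pos, fun s hs t ht hst => ?_⟩
    exact absurd (mem_orderedPairs hs ht hst) (by rw [he]; exact notMem_empty _)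
  · obtain ⟨p, hp, hmax⟩ := hcomp.exists_isMaxOn hne hcont
    exact ⟨‖ω p.1 p.2 0‖, mem_ball_zero_iff.1
      ((hω.selfMap _ hp.1 _ hp.2.1 hp.2.2).mapsTo zero_mem_openUnitDisk),
      fun s hs t ht hst => hmax (mem_orderedPairs hs ht hst)⟩

theorem IsEvolutionFamily.isLeftContinuousFamily {a b : ℝ} {ω : ℝ → ℝ → ℂ → ℂ}
    (hω : IsEvolutionFamily (Icc a b) ω) (hc : IsJointlyContinuous (Icc a b) ω) :
    IsLeftContinuousFamily a b ω := by
  rw [hω.isLeftContinuousFamily_iff]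
  intro s hs z hz
  have hb : b ∈ Icc a b := right_mem_Icc.2 (hs.1.trans hs.2)
  refine (hω.isJointlyContinuous_iff.1 hc (s, b) (mem_orderedPairs hs hb hs.2) z hz).comp
    (f := fun σ => (σ, b)) (tendsto_nhdsWithin_iff.2
      ⟨(tendsto_id'.2 nhdsWithin_le_nhds).prodMk_nhds tendsto_const_nhds, ?_⟩)
  filter_upwards [self_mem_nhdsWithin] with σ hσ
  exact mem_orderedPairs hσ hb hσ.2

/-- Since `c - (t - s) ≤ s ≤ c ≤ t`, a vanishing length squeezes both end points to `c`. -/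
theorem twoSidedFilter_le {I : Set ℝ} {c : ℝ} :
    twoSidedFilter I c ≤ 𝓝[orderedPairs I] (c, c) := by
  have hmem : ∀ᶠ p in twoSidedFilter I c, p ∈ orderedPairs I ∧ p.1 ≤ c ∧ c ≤ p.2 :=
    mem_inf_of_right (mem_principal_self _)
  have hsub : Tendsto (fun p : ℝ × ℝ => p.2 - p.1) (twoSidedFilter I c) (𝓝 0) :=
    (tendsto_comap.mono_left inf_le_left).mono_right nhdsWithin_le_nhds
  have h1 : Tendsto Prod.fst (twoSidedFilter I c) (𝓝 c) := by
    refine tendsto_of_tendsto_of_tendsto_of_le_of_le' (by simpa using tendsto_const_nhds.sub hsub)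
      tendsto_const_nhds (g := fun p : ℝ × ℝ => c - (p.2 - p.1)) (h := fun _ => c) ?_ ?_
    · filter_upwards [hmem] with p hp
      linarith [hp.2.2]
    · filter_upwards [hmem] with p hp
      exact hp.2.1
  have h2 : Tendsto Prod.snd (twoSidedFilter I c) (𝓝 c) := by
    simpa using hsub.add h1
  exact tendsto_nhdsWithin_iff.2 ⟨h1.prodMk_nhds h2, hmem.mono fun p hp => hp.1⟩

theorem nhdsWithin_le_twoSidedFilter {I : Set ℝ} {c : ℝ} :
    𝓝[{p | p ∈ orderedPairs I ∧ p.1 < p.2 ∧ p.1 ≤ c ∧ c ≤ p.2}] (c, c) ≤ twoSidedFilter I c := by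
  refine le_inf (tendsto_iff_comap.1 (tendsto_nhdsWithin_iff.2 ⟨?_, ?_⟩)) ?_
  · have : Tendsto (fun p : ℝ × ℝ => p.2 - p.1) (𝓝 (c, c)) (𝓝 (c - c)) :=
      (continuous_snd.sub continuous_fst).tendsto (c, c)
    rw [sub_self] at this
    exact this.mono_left nhdsWithin_le_nhds
  · filter_upwards [self_mem_nhdsWithin] with p hp
    exact sub_pos.2 hp.2.1
  · rw [le_principal_iff]
    filter_upwards [self_mem_nhdsWithin] with p hp
    exact ⟨hp.1, hp.2.2⟩

theorem IsEvolutionFamily.continuousOn_deriv {a b : ℝ} {ω : ℝ → ℝ → ℂ → ℂ}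
    (hω : IsEvolutionFamily (Icc a b) ω) (hl : IsLeftContinuousFamily a b ω) :
    ContinuousOn (fun s => deriv (ω s b) 0) (Icc a b) := by
  intro s hs
  refine ((hl s hs).deriv ?_ Metric.isOpen_ball).tendsto_at zero_mem_openUnitDisk
  filter_upwards [self_mem_nhdsWithin] with σ hσ
  exact (hω.selfMap _ hσ _ (right_mem_Icc.2 (hs.1.trans hs.2)) hσ.2).differentiableOn

theorem IsEvolutionFamily.isJointlyContinuous_of_continuousOn_deriv {a b : ℝ}
    {ω : ℝ → ℝ → ℂ → ℂ} (hω : IsEvolutionFamily (Icc a b) ω)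
    (hb : IsHyperbolicallyBounded (Icc a b) ω)
    (h0 : ∀ c ∈ Icc a b,
      Tendsto (fun p : ℝ × ℝ => ω p.1 p.2 0) (twoSidedFilter (Icc a b) c) (𝓝 0))
    (hd : ContinuousOn (fun s => deriv (ω s b) 0) (Icc a b))
    (hne : ∀ s ∈ Icc a b, deriv (ω s b) 0 ≠ 0) :
    IsJointlyContinuous (Icc a b) ω := by
  refine hω.isJointlyContinuous_of_tendsto_id hb fun c hc => ?_
  obtain ⟨ρ, hρ, hb⟩ := hb
  have hbI : b ∈ Icc a b := right_mem_Icc.2 (hc.1.trans hc.2)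
  refine tendsto_of_forall_ultrafilter hρ (ψ := id)
    (l := 𝓝[{p | p ∈ orderedPairs (Icc a b) ∧ p.1 < p.2 ∧ p.1 ≤ c ∧ c ≤ p.2}] (c, c)) ?_ ?_ ?_
  · filter_upwards [self_mem_nhdsWithin] with p hp
    exact hω.selfMap _ hp.1.1 _ hp.1.2.1 hp.1.2.2
  · filter_upwards [self_mem_nhdsWithin] with p hp
    exact hb _ hp.1.1 _ hp.1.2.1 hp.1.2.2
  intro U hU φ hφ hlim
  have hmem : ∀ᶠ p in (U : Filter (ℝ × ℝ)), p ∈ orderedPairs (Icc a b) := by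
    filter_upwards [hU self_mem_nhdsWithin] with p hp
    exact hp.1
  have hnhds : Tendsto id (U : Filter (ℝ × ℝ)) (𝓝 (c, c)) := hU.trans nhdsWithin_le_nhds
  have hfst : Tendsto Prod.fst (U : Filter (ℝ × ℝ)) (𝓝[Icc a b] c) :=
    tendsto_nhdsWithin_iff.2 ⟨(continuous_fst.tendsto (c, c)).comp hnhds, hmem.mono fun p hp => hp.1⟩
  have hsnd : Tendsto Prod.snd (U : Filter (ℝ × ℝ)) (𝓝[Icc a b] c) :=
    tendsto_nhdsWithin_iff.2
      ⟨(continuous_snd.tendsto (c, c)).comp hnhds, hmem.mono fun p hp => hp.2.1⟩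
  have hφ0 : φ 0 = 0 := tendsto_nhds_unique (hlim 0 zero_mem_openUnitDisk)
    ((h0 c hc).mono_left (hU.trans nhdsWithin_le_twoSidedFilter))
  -- The limit `g` is not known to be `ω c b`, as left continuity is not assumed; only its
  -- derivative at 0 is determined, and that suffices.
  have hex : ∀ u : ℝ × ℝ → ℝ, Tendsto u U (𝓝[Icc a b] c) → ∃ g, IsHolomorphicSelfMap g ∧
      (∀ z ∈ openUnitDisk, Tendsto (fun p => ω (u p) b z) U (𝓝 (g z))) ∧
      deriv g 0 = deriv (ω c b) 0 := by
    intro u hu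
    have humem := (tendsto_nhdsWithin_iff.1 hu).2
    have hsm : ∀ᶠ p in (U : Filter (ℝ × ℝ)), IsHolomorphicSelfMap (ω (u p) b) := by
      filter_upwards [humem] with p hp
      exact hω.selfMap _ hp _ hbI hp.2
    obtain ⟨g, hg, hglim⟩ := U.exists_isHolomorphicSelfMap_tendsto hρ hsm (by
      filter_upwards [humem] with p hp
      exact hb _ hp _ hbI hp.2)
    refine ⟨g, hg, hglim, ?_⟩
    have hlu := tendstoLocallyUniformlyOn_of_tendsto hsm hg.differentiableOn.continuousOn hglim
    exact tendsto_nhds_unique ((hlu.deriv (hsm.mono fun p hp => hp.differentiableOn)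
      Metric.isOpen_ball).tendsto_at zero_mem_openUnitDisk) ((hd c hc).tendsto.comp hu)
  obtain ⟨h, -, hhlim, hh'⟩ := hex _ hfst
  obtain ⟨g, hg, hglim, hg'⟩ := hex _ hsnd
  have hgφ : EqOn h (g ∘ φ) openUnitDisk := by
    intro z hz
    have h1 : Tendsto (fun p : ℝ × ℝ => ω p.2 b (ω p.1 p.2 z)) U (𝓝 (g (φ z))) := by
      refine tendsto_apply_of_tendsto (F := fun p : ℝ × ℝ => ω p.2 b) ?_ (hφ.mapsTo hz)
        (hlim z hz) (hglim _ (hφ.mapsTo hz))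
      filter_upwards [hmem] with p hp
      exact hω.selfMap _ hp.2.1 _ hbI hp.2.1.2
    refine tendsto_nhds_unique_of_eventuallyEq (hhlim z hz) h1 ?_
    filter_upwards [hmem] with p hp
    exact (hω.comp _ hp.1 _ hp.2.1 _ hbI hp.2.2 hp.2.1.2 _ hz).symm
  have hderiv : deriv h 0 = deriv g (φ 0) * deriv φ 0 := by
    rw [(hgφ.eventuallyEq_of_mem (Metric.isOpen_ball.mem_nhds zero_mem_openUnitDisk)).deriv_eq,
      _root_.deriv_comp]
    · exact hg.differentiableAt (hφ.mapsTo zero_mem_openUnitDisk)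
    · exact hφ.differentiableAt zero_mem_openUnitDisk
  rw [hφ0, hg', hh'] at hderiv
  exact hφ.eqOn_id hφ0 (mul_left_cancel₀ (hne c hc) (by rw [← hderiv, mul_one]))

theorem theorem1p6 (a b : ℝ) (hab : a < b) (ω : ℝ → ℝ → ℂ → ℂ)
    (hω : IsEvolutionFamily (Icc a b) ω) :
    List.TFAE [
      IsJointlyContinuous (Icc a b) ω,
      IsHyperbolicallyBounded (Icc a b) ω ∧ IsLeftContinuousFamily a b ω,
      IsHyperbolicallyBounded (Icc a b) ω ∧
        (∀ c ∈ Icc a b,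
          Tendsto (fun p : ℝ × ℝ => ω p.1 p.2 0) (twoSidedFilter (Icc a b) c) (𝓝 0)) ∧
        ContinuousOn (fun s => deriv (ω s b) 0) (Icc a b) ∧
        ∀ s ∈ Icc a b, deriv (ω s b) 0 ≠ 0] := by
  tfae_have 1 → 2 := fun hc => ⟨hω.isHyperbolicallyBounded hc, hω.isLeftContinuousFamily hc⟩
  tfae_have 2 → 1 := fun h => hω.isJointlyContinuous_of_isLeftContinuousFamily h.1 h.2
  tfae_have 1 → 3 := by
    intro hc
    refine ⟨hω.isHyperbolicallyBounded hc, fun c hcI => ?_,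
      hω.continuousOn_deriv (hω.isLeftContinuousFamily hc), fun s hs => ?_⟩
    · have h := hω.isJointlyContinuous_iff.1 hc (c, c) (mem_orderedPairs hcI hcI le_rfl) 0
        zero_mem_openUnitDisk
      rw [hω.diagonal _ hcI _ zero_mem_openUnitDisk] at h
      exact h.mono_left twoSidedFilter_le
    · have hsub : Icc s b ⊆ Icc a b := Icc_subset_Icc_left hs.1
      have hsω := hω.mono hsub
      refine hsω.deriv_ne_zero_of_isJointlyContinuous hs.2 ?_ zero_mem_openUnitDisk
      rw [hsω.isJointlyContinuous_iff]
      exact fun p hp z hz => (hω.isJointlyContinuous_iff.1 hc p (orderedPairs_mono hsub hp) z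
        hz).mono_left (nhdsWithin_mono p (orderedPairs_mono hsub))
  tfae_have 3 → 1 := fun h =>
    hω.isJointlyContinuous_of_continuousOn_deriv h.1 h.2.1 h.2.2.1 h.2.2.2
  tfae_finish
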